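/- Let $\varepsilon>0$ and let $H(K)$ be the reproducing kernel Hilbert space of real-valued functions on $[-1,1]$ with kernel $K(x,y)=e^{\varepsilon xy}$, $x,y\in[-1,1]$. For $n\in\mathbb N$ consider linear approximations $$A_nf=\sum_{k=1}^n f(x_k)\psi_k ,\qquad f\in H(K),\tag{1}$$ with pairwise distinct points $x_1,\dots,x_n\in[-1,1]$ and real-valued Lebesgue measurable functions $\psi_1,\dots,\psi_n$ on $[-1,1]$. Put $$e_\infty(A_n)=\sup_{0\neq f\in H(K)}\frac{\sup_{x\in[-1,1]}|f(x)-(A_nf)(x)|}{\|f\|_{H(K)}}\in[0,\infty],\qquad e_\infty^{\min}(n)=\inf_{A_n}e_\infty(A_n),$$ the infimum being over all approximations of the form (1) (over all points and all functions $\psi_k$). For $t>0$ let $$c_L(t)=\frac{e^{-\frac32t+2\sqrt t}}{2\sqrt\pi\,t^{1/4}}\Big(3+\sqrt{\tfrac{\pi}{e}}+\frac{2}{\sqrt\pi\,t^{1/4}}+\frac{7}{16\sqrt t}+\sqrt t\,(2+t)\Big),\qquad m_L(t)=\max\Big\{5t,\;t\big(1+\tfrac t2\big)^2,\;\tfrac9t\Big\},$$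 and let $$c_1=\sqrt{\frac{2}{1+\varepsilon}}\;e^{-\frac1{32}\varepsilon^2},\qquad c_2=2\sqrt{c_L(\varepsilon)} .$$ Then for every $n\ge m_L(\varepsilon)$ $$c_1\Big(\frac{\varepsilon^{1/2}}2\Big)^n(n!)^{-1/2}\;\le\;e_\infty^{\min}(n)\;\le\;c_2\,n^{-1/8}e^{\sqrt{\varepsilon n}}\Big(\frac{\varepsilon^{1/2}}2\Big)^n(n!)^{-1/2},$$ and for any pairwise distinct points $x_1,\dots,x_n\in[-1,1]$ there is a linear approximation $A_n$ of the form (1), using these points, such that $$c_1\Big(\frac{\varepsilon^{1/2}}2\Big)^n(n!)^{-1/2}\;\le\;e_\infty(A_n)\;\le\;\frac{c_2}2\,n^{-1/8}e^{\sqrt{\varepsilon n}}\,(2\varepsilon^{1/2})^n(n!)^{-1/2}.$$ -/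

import Mathlib

/-!
The worst-case error of `A` is the largest norm of the representer `r_x` of the error functional
`f ↦ f x - (A f) x`. Expanding the exponential kernel about an arbitrary centre `c` writes `‖r_x‖²`
as a weighted sum of the squared errors of `A` at `x` on the functions
`exp (ε c (x - c / 2)) (x - c) ^ j`, so that interpolation by polynomials, multiplied by the
exponential factor, leaves only the Lagrange remainders of monomials. These are the nodal
polynomial times complete homogeneous symmetric polynomials of the point and the nodes, the
coefficients of `∏ 1 / (1 - aᵢ X)`. Centring at the mean of the nodes removes the linear term of
the logarithm of this product and is what makes the error grow only like `exp √(ε n)`.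

For the lower bound, take a combination `p` of `T₀, …, Tₙ` that vanishes at the `n` nodes. Its
maximum on `[-1, 1]` is at least its root mean square for the arcsine distribution, where the `Tⱼ`
are orthogonal, while its norm in the reproducing kernel space is an explicit weighted `ℓ²` norm of
its coefficients.
-/

open scoped ENNReal Nat

namespace ExpKernel

/-- The domain `[-1, 1]`. -/
abbrev Dom : Type := Set.Icc (-1 : ℝ) 1

/-- The (possibly infinite) supremum norm `sup_{x ∈ [-1, 1]} |g x|`. -/
noncomputable def supNorm (g : Dom → ℝ) : ℝ≥0∞ := ⨆ x : Dom, ‖g x‖ₑ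

/-- The data of a linear approximation `A f = ∑ₖ f(xₖ) ψₖ`: pairwise distinct points
`xₖ ∈ [-1, 1]` and real-valued Lebesgue measurable functions `ψₖ` on `[-1, 1]`. -/
structure LinApprox (n : ℕ) where
  point : Fin n → Dom
  point_injective : Function.Injective point
  weight : Fin n → Dom → ℝ
  /-- Measurability with respect to the Lebesgue σ-algebra of `[-1, 1]` (the completion of the
  Borel σ-algebra under the restriction of Lebesgue measure). -/
  weight_measurable : ∀ k, MeasureTheory.NullMeasurable (weight k)
    (MeasureTheory.Measure.comap (Subtype.val : Dom → ℝ) MeasureTheory.volume)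

/-- The function `A f = ∑ₖ f(xₖ) ψₖ`. -/
noncomputable def LinApprox.apply {n : ℕ} (A : LinApprox n) (f : Dom → ℝ) : Dom → ℝ :=
  fun x => ∑ k : Fin n, f (A.point k) * A.weight k x

/-- The worst-case error `sup_{0 ≠ f ∈ H} ‖f - A f‖_∞ / ‖f‖_H` over a reproducing kernel Hilbert
space `H` of functions on `[-1, 1]`. -/
noncomputable def LinApprox.errorOn {n : ℕ} (A : LinApprox n) (H : Type*)
    [NormedAddCommGroup H] [InnerProductSpace ℝ H] [RKHS ℝ H Dom ℝ] : ℝ≥0∞ :=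
  ⨆ (f : H) (_ : f ≠ 0), supNorm (fun x => f x - A.apply f x) / ‖f‖ₑ

/-- A scalar kernel as a matrix of (multiplication) operators on `ℝ`. -/
noncomputable def kernelMatrix (K : Dom → Dom → ℝ) : Matrix Dom Dom (ℝ →L[ℝ] ℝ) :=
  Matrix.of fun x y => K x y • ContinuousLinearMap.id ℝ ℝ

/-- The worst-case error `e_∞(A)` over the reproducing kernel Hilbert space `H(K)` of a
positive-semidefinite kernel `K`. -/
noncomputable def worstCaseError (K : Dom → Dom → ℝ) (hK : (kernelMatrix K).PosSemidef)
    {n : ℕ} (A : LinApprox n) : ℝ≥0∞ :=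
  haveI : Fact (kernelMatrix K).PosSemidef := ⟨hK⟩
  A.errorOn (RKHS.OfKernel (kernelMatrix K))

/-- The `n`th minimal error `e_∞^min(n)` over `H(K)`. -/
noncomputable def minimalError (K : Dom → Dom → ℝ) (hK : (kernelMatrix K).PosSemidef)
    (n : ℕ) : ℝ≥0∞ :=
  ⨅ A : LinApprox n, worstCaseError K hK A

/-- The exponential kernel `K(x, y) = exp(ε x y)` on `[-1, 1]`. -/
noncomputable def expKernel (ε : ℝ) (x y : Dom) : ℝ := Real.exp (ε * x * y)

theorem expKernel_posSemidef {ε : ℝ} (hε : 0 ≤ ε) :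
    (kernelMatrix (expKernel ε)).PosSemidef := by
  have key := (RKHS.posSemidef_tfae (K := kernelMatrix (expKernel ε))).out 0 2
  refine key.2 ⟨?_, fun vv => ?_⟩
  · ext x y
    simp [kernelMatrix, expKernel, Matrix.conjTranspose_apply, mul_right_comm,
      show star (ContinuousLinearMap.id ℝ ℝ) = ContinuousLinearMap.id ℝ ℝ from
        star_one (ℝ →L[ℝ] ℝ)]
  · have h : ∀ x y : Dom, HasSum (fun k : ℕ => ε ^ k / k ! * ((x : ℝ) ^ k * (y : ℝ) ^ k))
        (expKernel ε x y) := by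
      intro x y
      have := NormedSpace.expSeries_div_hasSum_exp (ε * x * y : ℝ)
      rw [← Real.exp_eq_exp_ℝ] at this
      refine this.congr_fun ?_
      intro k
      simp only [mul_pow]
      ring
    have h2 : HasSum (fun k : ℕ => ε ^ k / k ! * (∑ x ∈ vv.support, (x : ℝ) ^ k * vv x) ^ 2)
        (∑ x ∈ vv.support, ∑ y ∈ vv.support, expKernel ε y x * (vv x * vv y)) := by
      refine (hasSum_sum fun x _ => hasSum_sum fun y _ =>
        (h y x).mul_right (vv x * vv y)).congr_fun ?_
      intro k
      rw [sq, Finset.sum_mul_sum, Finset.mul_sum]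
      refine Finset.sum_congr rfl fun x _ => ?_
      rw [Finset.mul_sum]
      refine Finset.sum_congr rfl fun y _ => ?_
      ring
    have h3 := h2.nonneg fun k => by positivity
    simp only [Finsupp.sum, RCLike.re_to_real]
    refine h3.trans_eq (Finset.sum_congr rfl fun x _ => Finset.sum_congr rfl fun y _ => ?_)
    simp [kernelMatrix]
    ring

/-- The constant `c_L(t)`, for `t > 0`. -/
noncomputable def cL (t : ℝ) : ℝ :=
  Real.exp (-(3 / 2) * t + 2 * √t) / (2 * √Real.pi * t ^ (1 / 4 : ℝ)) *
    (3 + √(Real.pi / Real.exp 1) + 2 / (√Real.pi * t ^ (1 / 4 : ℝ)) + 7 / (16 * √t)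
      + √t * (2 + t))

/-- The threshold `m_L(t)`, for `t > 0`. -/
noncomputable def mL (t : ℝ) : ℝ := max (max (5 * t) (t * (1 + t / 2) ^ 2)) (9 / t)

/-- The constant `c₁` in the lower bounds. -/
noncomputable def c₁ (ε : ℝ) : ℝ := √(2 / (1 + ε)) * Real.exp (-(1 / 32) * ε ^ 2)

/-- The constant `c₂` in the upper bounds. -/
noncomputable def c₂ (ε : ℝ) : ℝ := 2 * √(cL ε)

end ExpKernel

namespace ExpKernel

section Duality

variable {H : Type*} [NormedAddCommGroup H] [InnerProductSpace ℝ H] [CompleteSpace H]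
  [RKHS ℝ H Dom ℝ] {n : ℕ} (A : LinApprox n)

/-- The Riesz representer in `H` of the pointwise error functional `f ↦ f x - (A f) x`. -/
noncomputable def LinApprox.errorRep (H : Type*) [NormedAddCommGroup H] [InnerProductSpace ℝ H]
    [CompleteSpace H] [RKHS ℝ H Dom ℝ] (x : Dom) : H :=
  RKHS.kerFun H x (1 : ℝ) - ∑ k, A.weight k x • RKHS.kerFun H (A.point k) (1 : ℝ)

lemma LinApprox.inner_errorRep (f : H) (x : Dom) :
    inner ℝ f (A.errorRep H x) = f x - A.apply f x := by
  simp [errorRep, apply, inner_sub_right, inner_sum, inner_smul_right, mul_comm]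

lemma LinApprox.errorOn_eq_iSup_enorm_errorRep :
    A.errorOn H = ⨆ x, ‖A.errorRep H x‖ₑ := by
  simp only [errorOn, supNorm, ← A.inner_errorRep]
  apply le_antisymm
  · refine iSup₂_le fun f _ => ENNReal.div_le_of_le_mul (iSup_le fun x => ?_)
    calc ‖inner ℝ f (A.errorRep H x)‖ₑ ≤ ‖f‖ₑ * ‖A.errorRep H x‖ₑ := by
          simpa [enorm_eq_nnnorm, ← ENNReal.coe_mul] using nnnorm_inner_le_nnnorm (𝕜 := ℝ) f _
      _ ≤ (⨆ x, ‖A.errorRep H x‖ₑ) * ‖f‖ₑ := by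
          rw [mul_comm]
          gcongr
          exact le_iSup (fun x => ‖A.errorRep H x‖ₑ) x
  · refine iSup_le fun x => ?_
    rcases eq_or_ne (A.errorRep H x) 0 with h0 | h0
    · simp [h0]
    refine le_iSup₂_of_le (A.errorRep H x) h0 ?_
    rw [ENNReal.le_div_iff_mul_le (by simp [h0]) (by simp)]
    refine le_iSup_of_le x ?_
    rw [real_inner_self_eq_norm_mul_norm, enorm_mul, enorm_norm]

variable {ι : Type*} {a : ι → ℝ} {u : ι → Dom → ℝ}

lemma LinApprox.hasSum_errorRep_apply
    (h : ∀ x y, HasSum (fun j => a j * (u j x * u j y)) (RKHS.kernel H x y 1)) (x y : Dom) :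
    HasSum (fun j => a j * (u j x - A.apply (u j) x) * u j y) (A.errorRep H x y) := by
  have hval : A.errorRep H x y =
      RKHS.kernel H y x 1 - ∑ k, A.weight k x * RKHS.kernel H y (A.point k) 1 := by
    simp only [errorRep, RKHS.coe_sub, Pi.sub_apply, RKHS.kerFun_apply, sub_right_inj]
    rw [← RKHS.coeCLM_apply (𝕜 := ℝ), map_sum, Finset.sum_apply]
    simp [RKHS.kerFun_apply]
  rw [hval]
  refine ((h y x).sub (hasSum_sum fun k _ =>
    (h y (A.point k)).mul_left (A.weight k x))).congr_fun fun j => ?_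
  simp only [apply, mul_sub, sub_mul, Finset.mul_sum, Finset.sum_mul]
  congr 1
  · ring
  · exact Finset.sum_congr rfl fun k _ => by ring

lemma LinApprox.hasSum_norm_errorRep_sq
    (h : ∀ x y, HasSum (fun j => a j * (u j x * u j y)) (RKHS.kernel H x y 1)) (x : Dom) :
    HasSum (fun j => a j * (u j x - A.apply (u j) x) ^ 2) (‖A.errorRep H x‖ ^ 2) := by
  rw [← real_inner_self_eq_norm_sq, A.inner_errorRep, apply]
  refine ((A.hasSum_errorRep_apply h x x).sub (hasSum_sum fun k _ =>
    (A.hasSum_errorRep_apply h x (A.point k)).mul_right (A.weight k x))).congr_fun fun j => ?_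
  rw [sq, ← mul_assoc, mul_sub _ (u j x) (A.apply _ _)]
  nth_rw 3 [apply]
  simp only [Finset.mul_sum, mul_assoc]

end Duality

section Expansion

variable {ε : ℝ}

/-- The functions `x ↦ exp (ε c (x - c / 2)) (x - c) ^ j`, whose multiples by `√(ε ^ j / j!)`
form an orthonormal basis of the space of the exponential kernel, for every centre `c`
(if `0 < ε`). -/
noncomputable def expMonomial (ε c : ℝ) (j : ℕ) (x : Dom) : ℝ :=
  Real.exp (ε * c * (x - c / 2)) * (x - c) ^ j

lemma hasSum_expKernel (c : ℝ) (x y : Dom) :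
    HasSum (fun j : ℕ => ε ^ j / j ! * (expMonomial ε c j x * expMonomial ε c j y))
      (expKernel ε x y) := by
  have hexp : expKernel ε x y = Real.exp (ε * c * (x - c / 2)) * Real.exp (ε * c * (y - c / 2)) *
      Real.exp (ε * (x - c) * (y - c)) := by
    rw [expKernel, ← Real.exp_add, ← Real.exp_add]
    ring_nf
  rw [hexp, Real.exp_eq_exp_ℝ]
  refine ((NormedSpace.expSeries_div_hasSum_exp (ε * (x - c) * (y - c))).mul_left _).congr_fun
    fun j => ?_
  rw [expMonomial, expMonomial, Real.exp_eq_exp_ℝ, mul_pow, mul_pow]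
  ring

variable [Fact (kernelMatrix (expKernel ε)).PosSemidef] {n : ℕ}

lemma LinApprox.hasSum_norm_errorRep_expKernel_sq (A : LinApprox n) (c : ℝ) (x : Dom) :
    HasSum (fun j : ℕ => ε ^ j / j ! *
        (expMonomial ε c j x - A.apply (expMonomial ε c j) x) ^ 2)
      (‖A.errorRep (RKHS.OfKernel (kernelMatrix (expKernel ε))) x‖ ^ 2) := by
  refine A.hasSum_norm_errorRep_sq (fun x y => ?_) x
  rw [RKHS.OfKernel.kernel_ofKernel]
  simpa [kernelMatrix] using hasSum_expKernel c x y

end Expansion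

section GeometricSeries

open PowerSeries

variable {R : Type*} [CommRing R]

/-- The geometric series `∑ aᵐ Xᵐ = 1 / (1 - a X)`. The coefficients of a product of such series
are the complete homogeneous symmetric polynomials in the parameters. -/
noncomputable def geomSeries (a : R) : R⟦X⟧ := mk fun m => a ^ m

lemma coeff_geomSeries (a : R) (m : ℕ) : coeff m (geomSeries a) = a ^ m := coeff_mk _ _

lemma rescale_geomSeries (s a : R) : rescale s (geomSeries a) = geomSeries (s * a) := by
  ext m
  simp [coeff_geomSeries, mul_pow]

lemma geomSeries_mul_one_sub (a : R) : geomSeries a * (1 - C a * X) = 1 := by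
  simpa [rescale_X, geomSeries, rescale_mk] using
    congrArg (rescale a) (mk_one_mul_one_sub_eq_one R)

lemma geomSeries_sub_geomSeries (a b : R) :
    geomSeries a - geomSeries b = C (a - b) * X * geomSeries a * geomSeries b := by
  rw [map_sub]
  linear_combination geomSeries b * geomSeries_mul_one_sub a
    - geomSeries a * geomSeries_mul_one_sub b

variable {ι : Type*}

lemma exists_polynomial_pow_sub_eval_eq [Nontrivial R] (s : Finset ι) (v : ι → R) (c : R)
    (j : ℕ) : ∃ p : Polynomial R, p.degree < s.card ∧ ∀ y, (y - c) ^ j - p.eval y =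
      (∏ i ∈ s, (y - v i)) *
        coeff j (X ^ s.card * (geomSeries (y - c) * ∏ i ∈ s, geomSeries (v i - c))) := by
  classical
  induction s using Finset.induction_on with
  | empty => exact ⟨0, by simp, fun y => by simp [coeff_geomSeries]⟩
  | insert a s ha ih =>
    obtain ⟨p, hdeg, hp⟩ := ih
    set G := ∏ i ∈ s, geomSeries (v i - c) with hG
    set κ := coeff j (X ^ s.card * (geomSeries (v a - c) * G)) with hκ
    refine ⟨p + Polynomial.C κ * Lagrange.nodal s v, ?_, fun y => ?_⟩
    · rw [Finset.card_insert_of_notMem ha, Nat.cast_succ]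
      refine (Polynomial.degree_add_le _ _).trans_lt (max_lt (hdeg.trans ?_) ?_)
      · exact_mod_cast Nat.lt_succ_self _
      · refine (Polynomial.degree_mul_le_of_le Polynomial.degree_C_le
          Lagrange.degree_nodal.le).trans_lt ?_
        exact_mod_cast (zero_add _).trans_lt (Nat.lt_succ_self _)
    · have hsplit : X ^ s.card * (geomSeries (y - c) * G) =
          X ^ s.card * (geomSeries (v a - c) * G) +
          C (y - v a) * (X ^ (s.card + 1) * (geomSeries (y - c) * (geomSeries (v a - c) * G))) := by
        have h := geomSeries_sub_geomSeries (y - c) (v a - c)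
        rw [sub_sub_sub_cancel_right] at h
        linear_combination (X ^ s.card * G) * h
      have hy := hp y
      rw [hsplit, map_add, coeff_C_mul, ← hκ] at hy
      rw [Finset.card_insert_of_notMem ha, Finset.prod_insert ha, Finset.prod_insert ha, ← hG]
      simp only [Polynomial.eval_add, Polynomial.eval_mul, Polynomial.eval_C, Lagrange.eval_nodal]
      linear_combination hy

lemma pow_sub_eval_interpolate_eq {F : Type*} [Field F] [DecidableEq ι] {s : Finset ι} {v : ι → F}
    (hv : Set.InjOn v s) (c : F) (j : ℕ) (y : F) :
    (y - c) ^ j - (Lagrange.interpolate s v fun i => (v i - c) ^ j).eval y =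
      (∏ i ∈ s, (y - v i)) *
        coeff j (X ^ s.card * (geomSeries (y - c) * ∏ i ∈ s, geomSeries (v i - c))) := by
  obtain ⟨p, hdeg, hp⟩ := exists_polynomial_pow_sub_eval_eq s v c j
  have hinterp : p = Lagrange.interpolate s v fun i => (v i - c) ^ j :=
    Lagrange.eq_interpolate_of_eval_eq _ hv hdeg fun i hi => by
      have h := hp (v i)
      rw [Finset.prod_eq_zero hi (sub_self _), zero_mul] at h
      exact (sub_eq_zero.1 h).symm
  rw [← hinterp, hp]

end GeometricSeries

section L1Norm

open PowerSeries

variable {R : Type*} [NormedCommRing R]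

/-- The `ℓ¹` norm of the coefficient sequence of a power series. The norm with weights `s ^ m` is
the norm of `rescale s F`. -/
noncomputable def l1Norm (F : R⟦X⟧) : ℝ≥0∞ := ∑' m, ‖coeff m F‖ₑ

lemma l1Norm_mul_le (F G : R⟦X⟧) : l1Norm (F * G) ≤ l1Norm F * l1Norm G := by
  calc l1Norm (F * G)
      ≤ ∑' m, ∑ p ∈ Finset.HasAntidiagonal.antidiagonal m, ‖coeff p.1 F‖ₑ * ‖coeff p.2 G‖ₑ := by
        refine ENNReal.tsum_le_tsum fun m => ?_
        rw [coeff_mul]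
        refine (enorm_sum_le _ _).trans (Finset.sum_le_sum fun p _ => ?_)
        simp only [enorm_eq_nnnorm, ← ENNReal.coe_mul]
        exact_mod_cast nnnorm_mul_le _ _
    _ = ∑' p : ℕ × ℕ, ‖coeff p.1 F‖ₑ * ‖coeff p.2 G‖ₑ := by
        rw [← Finset.HasAntidiagonal.sigmaAntidiagonalEquivProd.tsum_eq, ENNReal.tsum_sigma']
        refine tsum_congr fun m => ?_
        rw [tsum_fintype, ← Finset.sum_coe_sort]
        rfl
    _ = l1Norm F * l1Norm G := by
        simp only [ENNReal.tsum_prod (f := fun i j => ‖coeff i F‖ₑ * ‖coeff j G‖ₑ),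
          ENNReal.tsum_mul_left, ENNReal.tsum_mul_right, l1Norm]

lemma l1Norm_one [NormOneClass R] : l1Norm (1 : R⟦X⟧) = 1 := by
  rw [l1Norm, tsum_eq_single 0 fun m hm => by simp [coeff_one, hm]]
  simp

lemma l1Norm_prod_le [NormOneClass R] {ι : Type*} (t : Finset ι) (F : ι → R⟦X⟧) :
    l1Norm (∏ i ∈ t, F i) ≤ ∏ i ∈ t, l1Norm (F i) := by
  classical
  induction t using Finset.induction_on with
  | empty => simp [l1Norm_one]
  | insert i t hi ih =>
    rw [Finset.prod_insert hi, Finset.prod_insert hi]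
    exact (l1Norm_mul_le _ _).trans (by gcongr)

lemma l1Norm_le_ofReal_of_hasSum {F : R⟦X⟧} {b : ℕ → ℝ} {M : ℝ} (hF : ∀ m, ‖coeff m F‖ ≤ b m)
    (hb : HasSum b M) : l1Norm F ≤ ENNReal.ofReal M := by
  rw [← hb.tsum_eq,
    ENNReal.ofReal_tsum_of_nonneg (fun m => (norm_nonneg _).trans (hF m)) hb.summable]
  exact ENNReal.tsum_le_tsum fun m => by
    rw [← ofReal_norm]
    exact ENNReal.ofReal_le_ofReal (hF m)

lemma sum_norm_coeff_le_of_l1Norm_le {F : R⟦X⟧} {M : ℝ} (hM : 0 ≤ M)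
    (hF : l1Norm F ≤ ENNReal.ofReal M) (s : Finset ℕ) : ∑ m ∈ s, ‖coeff m F‖ ≤ M := by
  rw [← ENNReal.ofReal_le_ofReal_iff hM, ENNReal.ofReal_sum_of_nonneg fun _ _ => norm_nonneg _]
  simpa only [ofReal_norm] using (ENNReal.sum_le_tsum s).trans hF

end L1Norm

section Derangements

open PowerSeries

lemma two_mul_numDerangements_succ_le (m : ℕ) : 2 * numDerangements (m + 1) ≤ (m + 1)! := by
  induction m using Nat.twoStepInduction with
  | zero => simp
  | one => simp [numDerangements, Nat.factorial]
  | more m ih₁ ih₂ =>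
    calc 2 * numDerangements (m + 3)
        = (m + 2) * (2 * numDerangements (m + 1) + 2 * numDerangements (m + 2)) := by
          rw [numDerangements_add_two]; ring
      _ ≤ (m + 2) * ((m + 1)! + (m + 2)!) := by gcongr
      _ = (m + 3)! := by rw [Nat.factorial_succ (m + 2), Nat.factorial_succ (m + 1)]; ring

/-- The series `exp (-a X) / (1 - a X)`, obtained from `1 / (1 - a X)` by removing the linear
term of its logarithm. -/
noncomputable def expGeomSeries (a : ℝ) : ℝ⟦X⟧ := rescale (-a) (exp ℝ) * geomSeries a

lemma coeff_expGeomSeries (a : ℝ) (m : ℕ) :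
    coeff m (expGeomSeries a) = a ^ m * (numDerangements m / m !) := by
  rw [expGeomSeries, coeff_mul, Finset.Nat.sum_antidiagonal_eq_sum_range_succ_mk,
    ← Int.cast_natCast (numDerangements m), numDerangements_sum, Int.cast_sum, Finset.sum_div,
    Finset.mul_sum]
  refine Finset.sum_congr rfl fun i hi => ?_
  obtain ⟨l, rfl⟩ := Nat.exists_eq_add_of_le (Nat.lt_succ_iff.1 (Finset.mem_range.1 hi))
  have hfac : (i ! : ℝ) * (i + 1).ascFactorial l = (i + l)! := by
    exact_mod_cast Nat.factorial_mul_ascFactorial i l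
  have hasc : ((i + 1).ascFactorial l : ℝ) ≠ 0 :=
    right_ne_zero_of_mul (hfac.trans_ne (Nat.cast_ne_zero.2 (Nat.factorial_ne_zero _)))
  simp only [coeff_rescale, coeff_exp, coeff_geomSeries, Nat.add_sub_cancel_left, ← hfac]
  push_cast
  rw [neg_pow, pow_add]
  field_simp

lemma prod_expGeomSeries {ι : Type*} (t : Finset ι) (a : ι → ℝ) :
    ∏ i ∈ t, expGeomSeries (a i) =
      rescale (-∑ i ∈ t, a i) (exp ℝ) * ∏ i ∈ t, geomSeries (a i) := by
  classical
  induction t using Finset.induction_on with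
  | empty => simp [rescale_zero]
  | insert i t hi ih =>
    rw [Finset.prod_insert hi, Finset.prod_insert hi, Finset.sum_insert hi, ih, expGeomSeries,
      neg_add, ← exp_mul_exp_eq_exp_add]
    ring

lemma prod_expGeomSeries_of_sum_eq_zero {ι : Type*} {t : Finset ι} {a : ι → ℝ}
    (ha : ∑ i ∈ t, a i = 0) : ∏ i ∈ t, expGeomSeries (a i) = ∏ i ∈ t, geomSeries (a i) := by
  simp [prod_expGeomSeries, ha, rescale_zero]

lemma norm_coeff_add_two_expGeomSeries_le (a : ℝ) (m : ℕ) :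
    ‖coeff (m + 2) (expGeomSeries a)‖ ≤ a ^ 2 / 2 * |a| ^ m := by
  have hder : (2 * numDerangements (m + 2) : ℝ) ≤ (m + 2)! := by
    exact_mod_cast two_mul_numDerangements_succ_le (m + 1)
  rw [coeff_expGeomSeries, norm_mul, norm_pow, Real.norm_eq_abs,
    Real.norm_of_nonneg (by positivity)]
  calc |a| ^ (m + 2) * (numDerangements (m + 2) / (m + 2)!) ≤ |a| ^ (m + 2) * (1 / 2) := by
        refine mul_le_mul_of_nonneg_left ?_ (by positivity)
        rw [div_le_div_iff₀ (by positivity) two_pos]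
        linarith
    _ = a ^ 2 / 2 * |a| ^ m := by rw [pow_add, sq_abs]; ring

lemma l1Norm_expGeomSeries_le {a : ℝ} (ha : |a| < 1) :
    l1Norm (expGeomSeries a) ≤ ENNReal.ofReal (Real.exp (a ^ 2 / (2 * (1 - |a|)))) := by
  let b : ℕ → ℝ
    | 0 => 1
    | 1 => 0
    | m + 2 => a ^ 2 / 2 * |a| ^ m
  have hb : HasSum b (a ^ 2 / (2 * (1 - |a|)) + 1) := by
    have hgeom := (hasSum_geometric_of_lt_one (abs_nonneg a) ha).mul_left (a ^ 2 / 2)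
    rw [← div_eq_mul_inv, div_div] at hgeom
    simpa [b, Finset.sum_range_succ] using (hasSum_nat_add_iff (f := b) 2).1 hgeom
  refine (l1Norm_le_ofReal_of_hasSum (b := b) (fun m => ?_) hb).trans
    (ENNReal.ofReal_le_ofReal (Real.add_one_le_exp _))
  match m with
  | 0 => simp [coeff_expGeomSeries, b]
  | 1 => simp [coeff_expGeomSeries, b]
  | m + 2 => simpa [b] using norm_coeff_add_two_expGeomSeries_le a m

lemma l1Norm_prod_geomSeries_le {ι : Type*} {t : Finset ι} {a : ι → ℝ}
    (hsum : ∑ i ∈ t, a i = 0) {ρ : ℝ} (hρ : ρ < 1) (ha : ∀ i ∈ t, |a i| ≤ ρ) :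
    l1Norm (∏ i ∈ t, geomSeries (a i)) ≤
      ENNReal.ofReal (Real.exp ((∑ i ∈ t, a i ^ 2) / (2 * (1 - ρ)))) := by
  rw [← prod_expGeomSeries_of_sum_eq_zero hsum, Finset.sum_div, Real.exp_sum,
    ENNReal.ofReal_prod_of_nonneg fun _ _ => (Real.exp_pos _).le]
  refine (l1Norm_prod_le _ _).trans (Finset.prod_le_prod' fun i hi => ?_)
  refine (l1Norm_expGeomSeries_le ((ha i hi).trans_lt hρ)).trans ?_
  have : 0 < 1 - ρ := sub_pos.2 hρ
  gcongr
  exact ha i hi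

end Derangements

section CenteredNodes

open PowerSeries

variable {ι : Type*} [Fintype ι] {z : ι → ℝ} {c : ℝ}

lemma abs_le_one_of_sum_sub_eq_zero [Nonempty ι] (hz : ∀ i, |z i| ≤ 1)
    (hc : ∑ i, (z i - c) = 0) : |c| ≤ 1 := by
  have hcard : (0 : ℝ) < Fintype.card ι := by exact_mod_cast Fintype.card_pos
  have hmean : Fintype.card ι * c = ∑ i, z i := by
    simpa [Finset.sum_sub_distrib, sub_eq_zero, eq_comm] using hc
  refine le_of_mul_le_mul_left ?_ hcard
  calc Fintype.card ι * |c| = |∑ i, z i| := by rw [← hmean, abs_mul, Nat.abs_cast]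
    _ ≤ ∑ i, |z i| := Finset.abs_sum_le_sum_abs _ _
    _ ≤ Fintype.card ι * 1 := by
        simpa using Finset.sum_le_sum fun i (_ : i ∈ Finset.univ) => hz i

lemma sum_sub_sq_le_of_sum_sub_eq_zero (hz : ∀ i, |z i| ≤ 1) (hc : ∑ i, (z i - c) = 0) :
    ∑ i, (z i - c) ^ 2 ≤ Fintype.card ι * (1 - c ^ 2) := by
  calc ∑ i, (z i - c) ^ 2 = ∑ i, (z i ^ 2 - c ^ 2 - 2 * c * (z i - c)) :=
        Finset.sum_congr rfl fun i _ => by ring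
    _ = ∑ i, (z i ^ 2 - c ^ 2) := by
        rw [Finset.sum_sub_distrib, ← Finset.mul_sum, hc, mul_zero, sub_zero]
    _ ≤ ∑ _i : ι, (1 - c ^ 2) := Finset.sum_le_sum fun i _ =>
        sub_le_sub_right ((sq_le_one_iff_abs_le_one _).2 (hz i)) _
    _ = Fintype.card ι * (1 - c ^ 2) := by simp [mul_sub]

lemma one_add_mul_lt_one_and_one_sub_sq_le {s a : ℝ} (hs : 0 ≤ s) (hs5 : 5 * s ^ 2 ≤ 1)
    (ha : a ≤ 1) : (1 + a) * s < 1 ∧ 1 - a ^ 2 ≤ 12 / 5 * (1 - (1 + a) * s) := by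
  have hs' : s ≤ 0.4473 := by nlinarith
  constructor
  · nlinarith
  · nlinarith [sq_nonneg (a - 6 / 5 * s)]

lemma l1Norm_prod_geomSeries_sub_le [Nonempty ι] (hz : ∀ i, |z i| ≤ 1)
    (hc : ∑ i, (z i - c) = 0) {s : ℝ} (hs : 0 ≤ s) (hs5 : 5 * s ^ 2 ≤ 1) :
    l1Norm (∏ i, geomSeries (s * (z i - c))) ≤
      ENNReal.ofReal (Real.exp (6 / 5 * (Fintype.card ι * s ^ 2))) := by
  obtain ⟨hρ, hvar⟩ := one_add_mul_lt_one_and_one_sub_sq_le hs hs5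
    (abs_le_one_of_sum_sub_eq_zero hz hc)
  set ρ := (1 + |c|) * s
  have hρ' : 0 < 1 - ρ := sub_pos.2 hρ
  have hsum : ∑ i, s * (z i - c) = 0 := by rw [← Finset.mul_sum, hc, mul_zero]
  refine (l1Norm_prod_geomSeries_le hsum hρ fun i _ => ?_).trans ?_
  · rw [abs_mul, abs_of_nonneg hs, mul_comm]
    exact mul_le_mul_of_nonneg_right ((abs_sub _ _).trans (by gcongr; exact hz i)) hs
  · refine ENNReal.ofReal_le_ofReal (Real.exp_le_exp.2 ?_)
    rw [div_le_iff₀ (by positivity)]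
    rw [sq_abs] at hvar
    calc ∑ i, (s * (z i - c)) ^ 2 = s ^ 2 * ∑ i, (z i - c) ^ 2 := by
          simp only [mul_pow, Finset.mul_sum]
      _ ≤ s ^ 2 * (Fintype.card ι * (12 / 5 * (1 - ρ))) := by
          gcongr
          exact (sum_sub_sq_le_of_sum_sub_eq_zero hz hc).trans (by gcongr)
      _ = 6 / 5 * (Fintype.card ι * s ^ 2) * (2 * (1 - ρ)) := by ring

end CenteredNodes

section CoefficientSums

open PowerSeries

lemma sum_pow_div_factorial_mul_coeff_sq_le {ε : ℝ} (hε : 0 ≤ ε) (n : ℕ) {G : ℝ⟦X⟧} {M : ℝ}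
    (hM : 0 ≤ M) (hG : l1Norm (rescale √(ε / (n + 1)) G) ≤ ENNReal.ofReal M) (N : ℕ) :
    ∑ j ∈ Finset.range N, ε ^ j / j ! * coeff j (X ^ n * G) ^ 2 ≤ ε ^ n / n ! * M ^ 2 := by
  set s := √(ε / (n + 1))
  have hs : s ^ 2 = ε / (n + 1) := Real.sq_sqrt (by positivity)
  calc ∑ j ∈ Finset.range N, ε ^ j / j ! * coeff j (X ^ n * G) ^ 2
      ≤ ∑ j ∈ Finset.range (n + N), ε ^ j / j ! * coeff j (X ^ n * G) ^ 2 :=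
        Finset.sum_le_sum_of_subset_of_nonneg (by simp) fun _ _ _ => by positivity
    _ = ∑ m ∈ Finset.range N, ε ^ (n + m) / (n + m)! * coeff m G ^ 2 := by
        rw [Finset.sum_range_add, Finset.sum_eq_zero, zero_add]
        · simp [coeff_X_pow_mul']
        · intro j hj
          simp [coeff_X_pow_mul', (Finset.mem_range.1 hj).not_ge]
    _ ≤ ∑ m ∈ Finset.range N, ε ^ n / n ! * ‖coeff m (rescale s G)‖ ^ 2 := by
        refine Finset.sum_le_sum fun m _ => ?_
        have hfac : (n ! : ℝ) * (n + 1) ^ m ≤ (n + m)! := by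
          exact_mod_cast Nat.factorial_mul_pow_le_factorial
        rw [coeff_rescale, Real.norm_eq_abs, sq_abs, mul_pow, pow_right_comm, hs, div_pow]
        calc ε ^ (n + m) / (n + m)! * coeff m G ^ 2
            ≤ ε ^ (n + m) / (n ! * (n + 1) ^ m) * coeff m G ^ 2 := by gcongr
          _ = ε ^ n / n ! * (ε ^ m / (n + 1) ^ m * coeff m G ^ 2) := by rw [pow_add]; field_simp
    _ ≤ ε ^ n / n ! * M ^ 2 := by
        rw [← Finset.mul_sum]
        gcongr
        exact (Finset.sum_sq_le_sq_sum_of_nonneg fun _ _ => norm_nonneg _).trans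
          (by gcongr; exact sum_norm_coeff_le_of_l1Norm_le hM hG _)

end CoefficientSums

section WeightedInterpolation

open PowerSeries

variable {ε : ℝ} {n : ℕ} {x : Fin n → Dom}

/-- The arithmetic mean of the nodes `x k` together with the evaluation point `y`. -/
noncomputable def nodeMean (x : Fin n → Dom) (y : ℝ) : ℝ := (y + ∑ i, (x i : ℝ)) / (n + 1)

lemma sub_add_sum_sub_nodeMean (x : Fin n → Dom) (y : ℝ) :
    (y - nodeMean x y) + ∑ i, ((x i : ℝ) - nodeMean x y) = 0 := by
  have hn : (n + 1 : ℝ) ≠ 0 := by positivity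
  rw [Finset.sum_sub_distrib, nodeMean]
  simp only [Finset.sum_const, Finset.card_univ, Fintype.card_fin, nsmul_eq_mul]
  field_simp
  ring

/-- Interpolation by the functions `y ↦ exp (ε c y) p(y)`, `p` a polynomial of degree `< n`, where
the centre `c` is itself chosen as the mean of the nodes and the evaluation point. -/
noncomputable def weightedInterp (ε : ℝ) (x : Fin n → Dom) (hx : Function.Injective x) :
    LinApprox n where
  point := x
  point_injective := hx
  weight k y := Real.exp (ε * nodeMean x y * (y - x k)) *
    (Lagrange.basis Finset.univ (fun i => (x i : ℝ)) k).eval (y : ℝ)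
  weight_measurable k := by
    refine Measurable.nullMeasurable (Continuous.measurable ?_)
    have := (Lagrange.basis Finset.univ (fun i => (x i : ℝ)) k).continuous
    unfold nodeMean
    fun_prop

lemma expMonomial_sub_weightedInterp_apply (hx : Function.Injective x) (j : ℕ) (y : Dom) :
    let c := nodeMean x y
    expMonomial ε c j y - (weightedInterp ε x hx).apply (expMonomial ε c j) y =
      Real.exp (ε * c * (y - c / 2)) * ((∏ k, ((y : ℝ) - x k)) *
        coeff j (X ^ n * (geomSeries (y - c) * ∏ k, geomSeries (x k - c)))) := by
  intro c
  have hinj : Set.InjOn (fun k => (x k : ℝ)) (Finset.univ : Finset (Fin n)) :=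
    (Subtype.val_injective.comp hx).injOn
  have h := pow_sub_eval_interpolate_eq hinj c j (y : ℝ)
  rw [Finset.card_univ, Fintype.card_fin] at h
  rw [← h, mul_sub, Lagrange.interpolate_apply, Polynomial.eval_finsetSum, Finset.mul_sum]
  refine congrArg₂ _ rfl (Finset.sum_congr rfl fun k _ => ?_)
  have hexp : Real.exp (ε * c * (y - c / 2)) =
      Real.exp (ε * c * (y - x k)) * Real.exp (ε * c * (x k - c / 2)) := by
    rw [← Real.exp_add]
    ring_nf
  rw [Polynomial.eval_mul, Polynomial.eval_C, hexp]
  simp only [expMonomial, weightedInterp]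
  ring

lemma l1Norm_rescale_geomSeries_nodeMean_le (hε : 0 ≤ ε) (hn : 5 * ε ≤ n) (y : Dom) :
    let c := nodeMean x y
    l1Norm (rescale √(ε / (n + 1)) (geomSeries (y - c) * ∏ k, geomSeries (x k - c))) ≤
      ENNReal.ofReal (Real.exp (6 / 5 * ε)) := by
  intro c
  let z : Option (Fin n) → ℝ := fun i => i.elim y fun k => x k
  have hz : ∀ i, |z i| ≤ 1
    | none => abs_le.2 y.2
    | some k => abs_le.2 (x k).2
  have hc : ∑ i, (z i - c) = 0 := by
    rw [Fintype.sum_option]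
    exact sub_add_sum_sub_nodeMean x (y : ℝ)
  have hs : √(ε / (n + 1)) ^ 2 = ε / (n + 1) := Real.sq_sqrt (by positivity)
  have hs5 : 5 * √(ε / (n + 1)) ^ 2 ≤ 1 := by
    rw [hs, ← mul_div_assoc, div_le_one (by positivity)]
    linarith
  have h := l1Norm_prod_geomSeries_sub_le hz hc (Real.sqrt_nonneg _) hs5
  have hcard : (Fintype.card (Option (Fin n)) : ℝ) * (ε / (n + 1)) = ε := by
    rw [Fintype.card_option, Fintype.card_fin]
    push_cast
    field_simp
  rw [hs, hcard, Fintype.prod_option] at h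
  simp only [map_mul, map_prod, rescale_geomSeries]
  exact h

lemma norm_errorRep_weightedInterp_sq_le (hε : 0 ≤ ε)
    [Fact (kernelMatrix (expKernel ε)).PosSemidef] (hn : 5 * ε ≤ n)
    (hx : Function.Injective x) (y : Dom) :
    ‖(weightedInterp ε x hx).errorRep (RKHS.OfKernel (kernelMatrix (expKernel ε))) y‖ ^ 2 ≤
      (∏ k, ((y : ℝ) - x k)) ^ 2 * (ε ^ n / n !) * Real.exp (17 / 5 * ε) := by
  set c := nodeMean x y
  set G := geomSeries ((y : ℝ) - c) * ∏ k, geomSeries ((x k : ℝ) - c)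
  have hy : (y : ℝ) ^ 2 ≤ 1 := (sq_le_one_iff_abs_le_one _).2 (abs_le.2 y.2)
  refine le_of_tendsto' ((weightedInterp ε x hx).hasSum_norm_errorRep_expKernel_sq c
    y).tendsto_sum_nat fun N => ?_
  calc ∑ j ∈ Finset.range N, ε ^ j / j ! *
        (expMonomial ε c j y - (weightedInterp ε x hx).apply (expMonomial ε c j) y) ^ 2
      = Real.exp (ε * (2 * c * y - c ^ 2)) * (∏ k, ((y : ℝ) - x k)) ^ 2 *
        ∑ j ∈ Finset.range N, ε ^ j / j ! * coeff j (X ^ n * G) ^ 2 := by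
        have hexp : Real.exp (ε * (2 * c * y - c ^ 2)) = Real.exp (ε * c * (y - c / 2)) ^ 2 := by
          rw [← Real.exp_nat_mul]
          ring_nf
        rw [hexp, Finset.mul_sum]
        refine Finset.sum_congr rfl fun j _ => ?_
        rw [expMonomial_sub_weightedInterp_apply hx j y]
        ring
    _ ≤ Real.exp ε * (∏ k, ((y : ℝ) - x k)) ^ 2 * (ε ^ n / n ! * Real.exp (6 / 5 * ε) ^ 2) := by
        gcongr
        · nlinarith [sq_nonneg (c - y)]
        · exact sum_pow_div_factorial_mul_coeff_sq_le hε n (Real.exp_pos _).le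
            (l1Norm_rescale_geomSeries_nodeMean_le hε hn y) N
    _ = (∏ k, ((y : ℝ) - x k)) ^ 2 * (ε ^ n / n !) * Real.exp (17 / 5 * ε) := by
        have hexp : Real.exp (17 / 5 * ε) = Real.exp ε * Real.exp (6 / 5 * ε) ^ 2 := by
          rw [← Real.exp_nat_mul, ← Real.exp_add]
          ring_nf
        rw [hexp]
        ring

end WeightedInterpolation

section Constants

variable {t n : ℝ}

lemma nine_le_mul_of_mL_le (ht : 0 < t) (hn : mL t ≤ n) : 9 ≤ t * n := by
  have h : 9 / t ≤ n := (le_max_right _ _).trans hn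
  rwa [div_le_iff₀' ht] at h

lemma five_mul_le_of_mL_le (hn : mL t ≤ n) : 5 * t ≤ n :=
  (le_max_left _ _).trans ((le_max_left _ _).trans hn)

lemma mul_sq_le_of_mL_le (hn : mL t ≤ n) : t * (1 + t / 2) ^ 2 ≤ n :=
  (le_max_right _ _).trans ((le_max_left _ _).trans hn)

lemma exponent_le_of_mL_le (ht : 0 < t) (hn : mL t ≤ n) :
    49 / 10 * t ≤ 2 * √t + 7 / 4 * √(t * n) := by
  have h9 := nine_le_mul_of_mL_le ht hn
  have h5 := five_mul_le_of_mL_le hn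
  have hq := mul_sq_le_of_mL_le hn
  have hst : 0 ≤ √t := Real.sqrt_nonneg t
  rcases le_total t 1 with h1 | h1
  · have hsqrt : 3 ≤ √(t * n) := Real.le_sqrt_of_sq_le (by linarith)
    linarith
  rcases le_total t 4 with h4 | h4
  · have hsqrt : 2.236 * t ≤ √(t * n) := Real.le_sqrt_of_sq_le (by nlinarith)
    have hconcave : (t + 2) / 3 ≤ √t := Real.le_sqrt_of_sq_le (by nlinarith)
    linarith
  · have hsqrt : t * (1 + t / 2) ≤ √(t * n) := Real.le_sqrt_of_sq_le (by nlinarith)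
    nlinarith

lemma exp_mul_two_div_le_cL (ht : 0 < t) :
    Real.exp (-(3 / 2) * t + 2 * √t) * 2 / (√Real.pi * t ^ (1 / 4 : ℝ)) ≤ cL t := by
  have hπe : 1 ≤ √(Real.pi / Real.exp 1) := by
    rw [Real.one_le_sqrt, one_le_div (Real.exp_pos 1)]
    linarith [Real.pi_gt_three, Real.exp_one_lt_d9]
  have hfactor : (4 : ℝ) ≤ 3 + √(Real.pi / Real.exp 1) + 2 / (√Real.pi * t ^ (1 / 4 : ℝ)) +
      7 / (16 * √t) + √t * (2 + t) := by
    have h₁ : 0 ≤ 2 / (√Real.pi * t ^ (1 / 4 : ℝ)) := by positivity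
    have h₂ : 0 ≤ 7 / (16 * √t) := by positivity
    have h₃ : 0 ≤ √t * (2 + t) := by positivity
    linarith
  calc Real.exp (-(3 / 2) * t + 2 * √t) * 2 / (√Real.pi * t ^ (1 / 4 : ℝ))
      = Real.exp (-(3 / 2) * t + 2 * √t) / (2 * √Real.pi * t ^ (1 / 4 : ℝ)) * 4 := by
        field_simp; ring
    _ ≤ cL t := by rw [cL]; gcongr

lemma cL_nonneg (ht : 0 < t) : 0 ≤ cL t := le_trans (by positivity) (exp_mul_two_div_le_cL ht)

lemma sqrt_pi_mul_sqrt_le_two_mul_exp {u : ℝ} (hu : 0 ≤ u) :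
    √Real.pi * √u ≤ 2 * Real.exp (u / 4) := by
  rw [← Real.sqrt_mul Real.pi_pos.le]
  refine Real.sqrt_le_iff.2 ⟨by positivity, ?_⟩
  have htangent : u / 2 ≤ Real.exp (u / 2 - 1) := by linarith [Real.add_one_le_exp (u / 2 - 1)]
  have hsq : Real.exp (u / 4) ^ 2 = Real.exp (u / 2 - 1) * Real.exp 1 := by
    rw [← Real.exp_nat_mul, ← Real.exp_add]
    ring_nf
  have he : 2 ≤ Real.exp 1 := by linarith [Real.exp_one_gt_d9]
  calc Real.pi * u ≤ 4 * u := by gcongr; exact Real.pi_lt_four.le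
    _ = 4 * (u / 2 * 2) := by ring
    _ ≤ 4 * (Real.exp (u / 2 - 1) * Real.exp 1) := by gcongr
    _ = (2 * Real.exp (u / 4)) ^ 2 := by rw [mul_pow, hsq]; ring

lemma exp_le_cL_mul_of_mL_le (ht : 0 < t) (hn : mL t ≤ n) :
    Real.exp (17 / 5 * t) ≤ cL t * n ^ (-(1 / 4) : ℝ) * Real.exp √(t * n) ^ 2 := by
  have hn0 : 0 < n := lt_of_lt_of_le (by positivity) (five_mul_le_of_mL_le hn)
  set u := √(t * n) with hu
  have hu0 : 0 < u := Real.sqrt_pos.2 (by positivity)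
  have hquart : t ^ (1 / 4 : ℝ) * n ^ (1 / 4 : ℝ) = √u := by
    rw [← Real.mul_rpow ht.le hn0.le, hu, Real.sqrt_eq_rpow, Real.sqrt_eq_rpow,
      ← Real.rpow_mul (by positivity)]
    norm_num
  calc Real.exp (17 / 5 * t) ≤ Real.exp (-(3 / 2) * t + 2 * √t + 7 / 4 * u) :=
        Real.exp_le_exp.2 (by linarith [exponent_le_of_mL_le ht hn])
    _ = Real.exp (-(3 / 2) * t + 2 * √t) * 2 * Real.exp u ^ 2 / (2 * Real.exp (u / 4)) := by
        rw [mul_right_comm, mul_comm _ (2 : ℝ), mul_div_mul_left _ _ two_ne_zero,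
          eq_div_iff (Real.exp_pos _).ne', ← Real.exp_nat_mul, ← Real.exp_add, ← Real.exp_add]
        ring_nf
    _ ≤ Real.exp (-(3 / 2) * t + 2 * √t) * 2 * Real.exp u ^ 2 / (√Real.pi * √u) := by
        refine div_le_div_of_nonneg_left (by positivity) (by positivity) ?_
        exact sqrt_pi_mul_sqrt_le_two_mul_exp hu0.le
    _ = Real.exp (-(3 / 2) * t + 2 * √t) * 2 / (√Real.pi * t ^ (1 / 4 : ℝ)) *
          n ^ (-(1 / 4) : ℝ) * Real.exp u ^ 2 := by
        rw [← hquart, Real.rpow_neg hn0.le]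
        field_simp
    _ ≤ cL t * n ^ (-(1 / 4) : ℝ) * Real.exp u ^ 2 := by
        gcongr
        exact exp_mul_two_div_le_cL ht

end Constants

lemma rpow_neg_half_sq {a : ℝ} (ha : 0 ≤ a) : (a ^ (-(1 / 2) : ℝ)) ^ 2 = a⁻¹ := by
  rw [← Real.rpow_mul_natCast ha]
  norm_num [Real.rpow_neg_one]

lemma worstCaseError_weightedInterp_le {ε : ℝ} (hε : 0 < ε) {n : ℕ} (hn : mL ε ≤ n)
    {x : Fin n → Dom} (hx : Function.Injective x) {W : ℝ}
    (hW : ∀ y : Dom, |∏ k, ((y : ℝ) - x k)| ≤ W) :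
    worstCaseError (expKernel ε) (expKernel_posSemidef hε.le) (weightedInterp ε x hx) ≤
      ENNReal.ofReal (W * (√(cL ε) * (n : ℝ) ^ (-(1 / 8) : ℝ) * Real.exp √(ε * n) * √ε ^ n *
        (n ! : ℝ) ^ (-(1 / 2) : ℝ))) := by
  have : Fact (kernelMatrix (expKernel ε)).PosSemidef := ⟨expKernel_posSemidef hε.le⟩
  rw [worstCaseError, LinApprox.errorOn_eq_iSup_enorm_errorRep]
  refine iSup_le fun y => ?_
  rw [← ofReal_norm]
  have hW0 : 0 ≤ W := (abs_nonneg _).trans (hW y)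
  refine ENNReal.ofReal_le_ofReal (le_of_sq_le_sq ?_ (by positivity))
  have hrpow : ((n : ℝ) ^ (-(1 / 8) : ℝ)) ^ 2 = (n : ℝ) ^ (-(1 / 4) : ℝ) := by
    rw [← Real.rpow_mul_natCast n.cast_nonneg]
    norm_num
  calc ‖(weightedInterp ε x hx).errorRep (RKHS.OfKernel (kernelMatrix (expKernel ε))) y‖ ^ 2
      ≤ (∏ k, ((y : ℝ) - x k)) ^ 2 * (ε ^ n / n !) * Real.exp (17 / 5 * ε) :=
        norm_errorRep_weightedInterp_sq_le hε.le (five_mul_le_of_mL_le hn) hx y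
    _ ≤ W ^ 2 * (ε ^ n / n !) *
        (cL ε * (n : ℝ) ^ (-(1 / 4) : ℝ) * Real.exp √(ε * n) ^ 2) := by
        refine mul_le_mul (mul_le_mul_of_nonneg_right ?_ (by positivity))
          (exp_le_cL_mul_of_mL_le hε hn) (by positivity) (by positivity)
        exact sq_le_sq.2 ((hW y).trans (le_abs_self W))
    _ = (W * (√(cL ε) * (n : ℝ) ^ (-(1 / 8) : ℝ) * Real.exp √(ε * n) * √ε ^ n *
        (n ! : ℝ) ^ (-(1 / 2) : ℝ))) ^ 2 := by
        simp only [mul_pow, Real.sq_sqrt (cL_nonneg hε), rpow_neg_half_sq (Nat.cast_nonneg _),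
          hrpow, pow_right_comm _ n 2, Real.sq_sqrt hε.le]
        ring

section ChebyshevCoefficients

open Polynomial

lemma coeff_T_add_two_succ {R : Type*} [CommRing R] (n k : ℕ) :
    (Chebyshev.T R ((n + 2 : ℕ) : ℤ)).coeff (k + 1) =
      2 * (Chebyshev.T R ((n + 1 : ℕ) : ℤ)).coeff k - (Chebyshev.T R (n : ℤ)).coeff (k + 1) := by
  push_cast
  rw [Chebyshev.T_add_two, coeff_sub, mul_assoc, ← C_ofNat, coeff_C_mul, coeff_X_mul]

lemma coeff_T_add_two_zero {R : Type*} [CommRing R] (n : ℕ) :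
    (Chebyshev.T R ((n + 2 : ℕ) : ℤ)).coeff 0 = -(Chebyshev.T R (n : ℤ)).coeff 0 := by
  push_cast
  rw [Chebyshev.T_add_two, coeff_sub, mul_assoc, ← C_ofNat, coeff_C_mul, coeff_X_mul_zero,
    mul_zero, zero_sub]

lemma coeff_T_eq_zero_of_odd {R : Type*} [CommRing R] {n k : ℕ} (hnk : Odd (n + k)) :
    (Chebyshev.T R (n : ℤ)).coeff k = 0 := by
  induction n using Nat.twoStepInduction generalizing k with
  | zero =>
    have hk : k ≠ 0 := by grind
    simp [coeff_one, hk]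
  | one =>
    have hk : 1 ≠ k := by grind
    simp [coeff_X, hk]
  | more n ih ih' =>
    rcases k with _ | k
    · rw [coeff_T_add_two_zero, ih (by grind), neg_zero]
    · rw [coeff_T_add_two_succ, ih (by grind), ih' (by grind), mul_zero, sub_zero]

lemma coeff_T_self {F : Type*} [Field F] [CharZero F] (k : ℕ) :
    (Chebyshev.T F (k : ℤ)).coeff k = 2 ^ (k - 1) := by
  simpa [leadingCoeff, Chebyshev.natDegree_T] using Chebyshev.leadingCoeff_T F (k : ℤ)

lemma coeff_T_two_mul_add {F : Type*} [Field F] [CharZero F] {i k : ℕ} (hik : 2 * i + k ≠ 0) :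
    (Chebyshev.T F ((2 * i + k : ℕ) : ℤ)).coeff k =
      (-1) ^ i * 2 ^ k * ((2 * i + k : ℕ) : F) * ((i + k - 1)! : F) / (2 * (k ! * i !)) := by
  have factorial_ne_zero (m : ℕ) : (m ! : F) ≠ 0 := Nat.cast_ne_zero.2 m.factorial_ne_zero
  induction i generalizing k with
  | zero =>
    obtain ⟨m, rfl⟩ := Nat.exists_eq_succ_of_ne_zero (by omega : k ≠ 0)
    rw [mul_zero, zero_add, coeff_T_self]
    simp only [Nat.succ_eq_add_one, Nat.add_sub_cancel, Nat.factorial_succ]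
    have := factorial_ne_zero m
    have := Nat.cast_add_one_ne_zero (R := F) m
    push_cast
    field_simp
    simp [pow_succ]
  | succ i ih =>
    induction k with
    | zero =>
      rw [show 2 * (i + 1) + 0 = 2 * i + 2 by ring, coeff_T_add_two_zero]
      rcases i with _ | i
      · simp
      · rw [show 2 * (i + 1) = 2 * (i + 1) + 0 by ring, ih (by omega)]
        simp only [add_zero, Nat.add_sub_cancel, Nat.factorial_succ]
        have := factorial_ne_zero i
        have := Nat.cast_add_one_ne_zero (R := F) i
        have : (i : F) + 1 + 1 ≠ 0 := by exact_mod_cast (i + 1).succ_ne_zero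
        push_cast
        field_simp
        ring
    | succ k ihk =>
      rw [show 2 * (i + 1) + (k + 1) = 2 * i + (k + 1) + 2 by ring, coeff_T_add_two_succ,
        show 2 * i + (k + 1) + 1 = 2 * (i + 1) + k by ring, ihk (by omega), ih (by omega),
        show i + 1 + k - 1 = i + k by omega, show i + (k + 1) - 1 = i + k by omega,
        show i + 1 + (k + 1) - 1 = i + k + 1 by omega]
      simp only [Nat.factorial_succ]
      have := factorial_ne_zero i
      have := factorial_ne_zero k
      have := Nat.cast_add_one_ne_zero (R := F) i
      have := Nat.cast_add_one_ne_zero (R := F) k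
      push_cast
      field_simp
      ring

end ChebyshevCoefficients

section Factorials

lemma factorial_add_mul_factorial_le {a b : ℕ} (hab : a ≤ b) (d : ℕ) :
    (a + d)! * b ! ≤ a ! * (b + d)! := by
  calc (a + d)! * b ! = a ! * b ! * (a + 1).ascFactorial d := by
        rw [← Nat.factorial_mul_ascFactorial]; ring
    _ ≤ a ! * b ! * (b + 1).ascFactorial d := by gcongr
    _ = a ! * (b + d)! := by rw [mul_assoc, Nat.factorial_mul_ascFactorial]

lemma le_one_add_two_div_mul_factorial_mul_sub {n i : ℕ} (hi : 2 * i ≤ n) :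
    (n : ℝ) ≤ (1 + 2 / n) * i ! * (n - i) := by
  rcases n.eq_zero_or_pos with rfl | hn
  · simp [show i = 0 by omega]
  have hn : (0 : ℝ) < n := by exact_mod_cast hn
  have hi : 2 * (i : ℝ) ≤ n := by exact_mod_cast hi
  have one_le : (1 : ℝ) ≤ i ! := by exact_mod_cast i.factorial_pos
  have self_le : (i : ℝ) ≤ i ! := by exact_mod_cast i.self_le_factorial
  have hni : 0 ≤ (n : ℝ) - i := by linarith [i.cast_nonneg (α := ℝ)]
  calc (n : ℝ) ≤ n + i * (n - 2 * i) / n :=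
        le_add_of_nonneg_right (div_nonneg (mul_nonneg i.cast_nonneg (by linarith)) hn.le)
    _ = (1 + 2 / n * i) * (n - i) := by field_simp; ring
    _ ≤ (1 * i ! + 2 / n * i !) * (n - i) := by gcongr; linarith
    _ = (1 + 2 / n) * i ! * (n - i) := by ring

lemma mul_factorial_sq_le {i k : ℕ} (hik : 2 * i + k ≠ 0) :
    (((2 * i + k : ℕ) : ℝ) * (i + k - 1)!) ^ 2 ≤
      (1 + 2 / (2 * i + k : ℕ)) * ((2 * i + k)! * k ! * i !) := by
  set n := 2 * i + k with hn
  have hi : 2 * i ≤ n := by omega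
  have hi' : 2 * (i : ℝ) ≤ n := by exact_mod_cast hi
  have hn_pos : (0 : ℝ) < n := by exact_mod_cast Nat.pos_of_ne_zero hik
  have hni : (n : ℝ) - i = (i + k : ℕ) := by rw [hn]; push_cast; ring
  have hmid : (i + k)! = (i + k) * (i + k - 1)! := (Nat.mul_factorial_pred (by omega)).symm
  have htop : n ! = n * (n - 1)! := (Nat.mul_factorial_pred hik).symm
  have hconvex : (i + k - 1)! * (i + k)! ≤ k ! * (n - 1)! := by
    rcases i.eq_zero_or_pos with rfl | hi_pos
    · simp [hn, mul_comm]
    · convert factorial_add_mul_factorial_le (Nat.le_add_left k i) (i - 1) using 3 <;> omega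
  refine le_of_mul_le_mul_right ?_ (by linarith : (0 : ℝ) < n - i)
  calc ((n : ℝ) * (i + k - 1)!) ^ 2 * (n - i)
      = (n : ℝ) ^ 2 * ((i + k - 1)! * (i + k)! : ℕ) := by rw [hni, hmid]; push_cast; ring
    _ ≤ (n : ℝ) ^ 2 * (k ! * (n - 1)! : ℕ) := by gcongr
    _ = n * (n ! * k !) := by rw [htop]; push_cast; ring
    _ ≤ (1 + 2 / n) * i ! * (n - i) * (n ! * k !) := by
        gcongr; exact le_one_add_two_div_mul_factorial_mul_sub hi
    _ = (1 + 2 / n) * (n ! * k ! * i !) * (n - i) := by ring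

lemma succ_pow_le_three_mul_pow {l m : ℕ} (hlm : l ≤ m) :
    ((m + 1 : ℕ) : ℝ) ^ l ≤ 3 * (m : ℝ) ^ l := by
  rcases m.eq_zero_or_pos with rfl | hm
  · obtain rfl : l = 0 := by omega
    norm_num
  have : (0 : ℝ) < m := by exact_mod_cast hm
  calc ((m + 1 : ℕ) : ℝ) ^ l = (1 + (m : ℝ)⁻¹) ^ l * (m : ℝ) ^ l := by
        rw [← mul_pow]
        congr 1
        push_cast
        field_simp
    _ ≤ (1 + (m : ℝ)⁻¹) ^ m * (m : ℝ) ^ l := by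
        gcongr
        exact le_add_of_nonneg_right (by positivity)
    _ ≤ Real.exp 1 * (m : ℝ) ^ l := by gcongr; exact Real.one_add_inv_pow_le_exp
    _ ≤ 3 * (m : ℝ) ^ l := by gcongr; exact Real.exp_one_lt_three.le

lemma pow_mul_factorial_sub_le {l m : ℕ} (hlm : l ≤ m) :
    (m : ℝ) ^ l * (m - l)! ≤ 3 ^ l * m ! := by
  induction m generalizing l with
  | zero => simp [Nat.le_zero.1 hlm]
  | succ m ih =>
    rcases l with _ | l
    · simp
    have hlm : l ≤ m := by omega
    rw [Nat.add_sub_add_right]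
    calc ((m + 1 : ℕ) : ℝ) ^ (l + 1) * (m - l)!
        = (m + 1 : ℕ) * (((m + 1 : ℕ) : ℝ) ^ l * (m - l)!) := by ring
      _ ≤ (m + 1 : ℕ) * (3 * (m : ℝ) ^ l * (m - l)!) := by
          gcongr; exact succ_pow_le_three_mul_pow hlm
      _ = 3 * (m + 1 : ℕ) * ((m : ℝ) ^ l * (m - l)!) := by ring
      _ ≤ 3 * (m + 1 : ℕ) * (3 ^ l * m !) := by gcongr 3 * (m + 1 : ℕ) * ?_; exact ih hlm
      _ = 3 ^ (l + 1) * (m + 1)! := by rw [Nat.factorial_succ]; push_cast; ring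

end Factorials

section CoefficientNorm

open Polynomial

/-- The squared norm `∑ pᵢ² i! / εⁱ` of a polynomial `p` in the space of the kernel
`exp (ε x y)`, where the monomials are orthogonal. -/
noncomputable def coeffNormSq (ε : ℝ) (p : ℝ[X]) : ℝ :=
  p.sum fun i a => a ^ 2 * (i ! / ε ^ i)

lemma coeffNormSq_eq_sum_range (ε : ℝ) {p : ℝ[X]} {m : ℕ} (hp : p.natDegree < m) :
    coeffNormSq ε p = ∑ i ∈ Finset.range m, p.coeff i ^ 2 * (i ! / ε ^ i) :=
  p.sum_over_range' (fun _ => by simp) m hp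

lemma sum_range_succ_eq_sum_sub_two_mul {M : Type*} [AddCommMonoid M] {n : ℕ} {f : ℕ → M}
    (hf : ∀ k, Odd (n + k) → f k = 0) :
    ∑ k ∈ Finset.range (n + 1), f k = ∑ i ∈ Finset.range (n / 2 + 1), f (n - 2 * i) := by
  symm
  refine Finset.sum_of_injOn (fun i => n - 2 * i) ?_ ?_ ?_ fun _ _ => rfl
  · intro i hi j hj hij
    simp only [Finset.coe_range, Set.mem_Iio] at hi hj hij
    omega
  · intro i _
    simp only [Finset.coe_range, Set.mem_Iio]
    omega
  · intro k hk hk_image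
    refine hf k (Nat.not_even_iff_odd.1 fun ⟨r, hr⟩ => hk_image ⟨(n - k) / 2, ?_, ?_⟩)
    · simp only [Finset.coe_range, Set.mem_Iio]
      omega
    · simp only [Finset.mem_range] at hk ⊢
      omega

lemma coeff_T_sq_mul_le {ε : ℝ} (hε : 0 < ε) {i k : ℕ} (hik : 2 * i + k ≠ 0) :
    (Chebyshev.T ℝ ((2 * i + k : ℕ) : ℤ)).coeff k ^ 2 * (k ! / ε ^ k) ≤
      4 ^ (2 * i + k) * (2 * i + k)! / ε ^ (2 * i + k) / 4 * (1 + 2 / (2 * i + k : ℕ)) *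
        ((ε ^ 2 / 16) ^ i / i !) := by
  have hfac := mul_factorial_sq_le hik
  rw [coeff_T_two_mul_add hik]
  set n := 2 * i + k with hn
  have hpow : (4 : ℝ) ^ n / ε ^ n * (ε ^ 2 / 16) ^ i = 4 ^ k / ε ^ k := by
    rw [hn, pow_add, pow_add, pow_mul, pow_mul, div_pow, show (16 : ℝ) = 4 ^ 2 by norm_num]
    field_simp
  have hfour : ((2 : ℝ) ^ k) ^ 2 = 4 ^ k := by rw [pow_right_comm]; norm_num
  have hsign : ((-1 : ℝ) ^ i) ^ 2 = 1 := by rw [pow_right_comm]; simp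
  calc ((-1) ^ i * 2 ^ k * (n : ℝ) * (i + k - 1)! / (2 * (k ! * i !))) ^ 2 * (k ! / ε ^ k)
      = 4 ^ k / ε ^ k / (4 * (k ! * (i ! : ℝ) ^ 2)) * ((n : ℝ) * (i + k - 1)!) ^ 2 := by
        rw [div_pow, mul_pow, mul_pow, mul_pow, hsign, hfour]
        field_simp
        ring
    _ ≤ 4 ^ k / ε ^ k / (4 * (k ! * (i ! : ℝ) ^ 2)) * ((1 + 2 / n) * (n ! * k ! * i !)) := by
        gcongr
    _ = 4 ^ k / ε ^ k * (n ! / 4 * (1 + 2 / n) / i !) := by field_simp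
    _ = 4 ^ n * n ! / ε ^ n / 4 * (1 + 2 / n) * ((ε ^ 2 / 16) ^ i / i !) := by rw [← hpow]; ring

lemma coeffNormSq_T_le {ε : ℝ} (hε : 0 < ε) {n : ℕ} (hn : n ≠ 0) :
    coeffNormSq ε (Chebyshev.T ℝ (n : ℤ)) ≤
      4 ^ n * n ! / ε ^ n / 4 * (1 + 2 / n) * Real.exp (ε ^ 2 / 16) := by
  rw [coeffNormSq_eq_sum_range ε (m := n + 1) (by simp [Chebyshev.natDegree_T]),
    sum_range_succ_eq_sum_sub_two_mul fun k hk => by rw [coeff_T_eq_zero_of_odd hk]; simp]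
  calc ∑ i ∈ Finset.range (n / 2 + 1), (Chebyshev.T ℝ (n : ℤ)).coeff (n - 2 * i) ^ 2 *
          ((n - 2 * i)! / ε ^ (n - 2 * i))
      ≤ ∑ i ∈ Finset.range (n / 2 + 1),
          4 ^ n * n ! / ε ^ n / 4 * (1 + 2 / n) * ((ε ^ 2 / 16) ^ i / i !) := by
        refine Finset.sum_le_sum fun i hi => ?_
        have hin : 2 * i + (n - 2 * i) = n := by simp only [Finset.mem_range] at hi; omega
        simpa only [hin] using coeff_T_sq_mul_le hε (i := i) (k := n - 2 * i) (by omega)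
    _ ≤ 4 ^ n * n ! / ε ^ n / 4 * (1 + 2 / n) * Real.exp (ε ^ 2 / 16) := by
        rw [← Finset.mul_sum]
        gcongr
        exact Real.sum_le_exp_of_nonneg (by positivity) _

/-- The mean of `T_j²` with respect to the arcsine distribution on `[-1, 1]`. -/
noncomputable def chebyshevWeight (j : ℕ) : ℝ := if j = 0 then 1 else 1 / 2

lemma chebyshevWeight_pos (j : ℕ) : 0 < chebyshevWeight j := by
  rw [chebyshevWeight]; split_ifs <;> norm_num

lemma coeffNormSq_T_div_chebyshevWeight_le_of_ne_zero {ε : ℝ} (hε : 0 < ε) {n : ℕ}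
    (hn : n ≠ 0) :
    coeffNormSq ε (Chebyshev.T ℝ (n : ℤ)) / chebyshevWeight n ≤
      4 ^ n * n ! / ε ^ n * ((1 / 2 + 1 / n) * Real.exp (ε ^ 2 / 16)) := by
  rw [chebyshevWeight, if_neg hn, div_le_iff₀ (by norm_num)]
  exact (coeffNormSq_T_le hε hn).trans_eq (by ring)

lemma coeffNormSq_T_div_chebyshevWeight_le {ε : ℝ} (hε : 0 < ε) (n : ℕ) :
    coeffNormSq ε (Chebyshev.T ℝ (n : ℤ)) / chebyshevWeight n ≤
      4 ^ n * n ! / ε ^ n * (3 / 2 * Real.exp (ε ^ 2 / 16)) := by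
  rcases eq_or_ne n 0 with rfl | hn
  · have := Real.one_le_exp (by positivity : 0 ≤ ε ^ 2 / 16)
    have hone : coeffNormSq ε (1 : ℝ[X]) = 1 := by
      simp [coeffNormSq_eq_sum_range ε (p := 1) (m := 1)]
    simp only [Nat.cast_zero, Chebyshev.T_zero, hone, chebyshevWeight, if_true, pow_zero,
      Nat.factorial_zero, Nat.cast_one]
    linarith
  · refine (coeffNormSq_T_div_chebyshevWeight_le_of_ne_zero hε hn).trans ?_
    have : 1 / (n : ℝ) ≤ 1 := by simpa using Nat.cast_inv_le_one n
    gcongr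
    linarith

lemma pow_mul_factorial_div_le {ε : ℝ} (hε : 0 < ε) {n j : ℕ} (hn : 5 * ε ≤ n)
    (hj : j < n) : 4 ^ j * j ! / ε ^ j ≤ 4 ^ n * n ! / ε ^ n * (ε / (4 * n)) := by
  obtain ⟨l, rfl⟩ : ∃ l, n = j + l + 1 := ⟨n - j - 1, by omega⟩
  have hbase : (3 * (ε / 4)) ^ l ≤ ((j + l : ℕ) : ℝ) ^ l := by
    rcases l.eq_zero_or_pos with rfl | hl
    · simp
    have hjl : (1 : ℝ) ≤ (j + l : ℕ) := by exact_mod_cast (by omega : 1 ≤ j + l)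
    push_cast at hn hjl ⊢
    gcongr
    linarith
  have hkey : (ε / 4) ^ l * j ! ≤ (j + l)! := by
    refine le_of_mul_le_mul_left ?_ (by positivity : (0 : ℝ) < 3 ^ l)
    calc 3 ^ l * ((ε / 4) ^ l * j !) = (3 * (ε / 4)) ^ l * j ! := by rw [mul_pow]; ring
      _ ≤ ((j + l : ℕ) : ℝ) ^ l * j ! := by gcongr
      _ ≤ 3 ^ l * (j + l)! := by simpa using pow_mul_factorial_sub_le (Nat.le_add_left l j)
  calc 4 ^ j * j ! / ε ^ j = 4 ^ (j + l) / ε ^ (j + l) * ((ε / 4) ^ l * j !) := by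
        rw [pow_add, pow_add, div_pow]; field_simp
    _ ≤ 4 ^ (j + l) / ε ^ (j + l) * (j + l)! := by gcongr
    _ = 4 ^ (j + l + 1) * (j + l + 1)! / ε ^ (j + l + 1) * (ε / (4 * (j + l + 1 : ℕ))) := by
        rw [Nat.factorial_succ, pow_succ, pow_succ]
        push_cast
        field_simp

lemma sum_coeffNormSq_T_div_chebyshevWeight_le {ε : ℝ} (hε : 0 < ε) {n : ℕ} (hn : 5 * ε ≤ n)
    (hεn : 9 ≤ ε * n) :
    ∑ j ∈ Finset.range (n + 1), coeffNormSq ε (Chebyshev.T ℝ (j : ℤ)) / chebyshevWeight j ≤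
      4 ^ n * n ! / ε ^ n * ((1 + ε) / 2 * Real.exp (ε ^ 2 / 16)) := by
  have hn_ne : n ≠ 0 := by rintro rfl; norm_num at hεn
  set q := Real.exp (ε ^ 2 / 16)
  set B : ℝ := 4 ^ n * n ! / ε ^ n
  have hlow : ∀ j ∈ Finset.range n,
      coeffNormSq ε (Chebyshev.T ℝ (j : ℤ)) / chebyshevWeight j ≤
        B * (ε / (4 * n)) * (3 / 2 * q) := fun j hj =>
    (coeffNormSq_T_div_chebyshevWeight_le hε j).trans <| by
      gcongr; exact pow_mul_factorial_div_le hε hn (Finset.mem_range.1 hj)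
  have htop := coeffNormSq_T_div_chebyshevWeight_le_of_ne_zero hε hn_ne
  have hinv : 1 / (n : ℝ) ≤ ε / 9 := by
    rw [div_le_div_iff₀ (by positivity) (by norm_num)]
    linarith
  calc ∑ j ∈ Finset.range (n + 1), coeffNormSq ε (Chebyshev.T ℝ (j : ℤ)) / chebyshevWeight j
      ≤ ∑ j ∈ Finset.range n, B * (ε / (4 * n)) * (3 / 2 * q) + B * ((1 / 2 + 1 / n) * q) := by
        rw [Finset.sum_range_succ]
        exact add_le_add (Finset.sum_le_sum hlow) htop
    _ = B * ((3 / 8 * ε + 1 / 2 + 1 / n) * q) := by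
        rw [Finset.sum_const, Finset.card_range, nsmul_eq_mul]; field_simp; ring
    _ ≤ B * ((1 + ε) / 2 * q) := by gcongr; linarith

end CoefficientNorm

section ChebyshevSum

open Polynomial

/-- The polynomial with Chebyshev coefficients `a`. -/
noncomputable def chebyshevSum {m : ℕ} (a : Fin m → ℝ) : ℝ[X] :=
  ∑ j, C (a j) * Chebyshev.T ℝ ((j : ℕ) : ℤ)

variable {m : ℕ} (a : Fin m → ℝ)

lemma coeff_chebyshevSum (i : ℕ) :
    (chebyshevSum a).coeff i = ∑ j, a j * (Chebyshev.T ℝ ((j : ℕ) : ℤ)).coeff i := by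
  simp only [chebyshevSum, finsetSum_coeff, coeff_C_mul]

lemma eval_chebyshevSum (x : ℝ) :
    (chebyshevSum a).eval x = ∑ j, a j * (Chebyshev.T ℝ ((j : ℕ) : ℤ)).eval x := by
  simp only [chebyshevSum, eval_finsetSum, eval_mul, eval_C]

lemma coeffNormSq_chebyshevSum_le {ε : ℝ} (hε : 0 < ε) :
    coeffNormSq ε (chebyshevSum a) ≤ (∑ j : Fin m, chebyshevWeight j * a j ^ 2) *
      ∑ j : Fin m, coeffNormSq ε (Chebyshev.T ℝ ((j : ℕ) : ℤ)) / chebyshevWeight j := by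
  set N := (chebyshevSum a).natDegree + 1 + m
  have hT (j : Fin m) : coeffNormSq ε (Chebyshev.T ℝ ((j : ℕ) : ℤ)) =
      ∑ i ∈ Finset.range N, (Chebyshev.T ℝ ((j : ℕ) : ℤ)).coeff i ^ 2 * (i ! / ε ^ i) :=
    coeffNormSq_eq_sum_range ε (by rw [Chebyshev.natDegree_T, Int.natAbs_natCast]; omega)
  simp only [hT, Finset.sum_div]
  rw [coeffNormSq_eq_sum_range ε (by omega : (chebyshevSum a).natDegree < N), Finset.sum_comm,
    Finset.mul_sum]
  refine Finset.sum_le_sum fun i _ => ?_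
  have cauchy_schwarz := Finset.sum_sq_le_sum_mul_sum_of_sq_le_mul Finset.univ
    (r := fun j => a j * (Chebyshev.T ℝ ((j : ℕ) : ℤ)).coeff i)
    (f := fun j => chebyshevWeight j * a j ^ 2)
    (g := fun j => (Chebyshev.T ℝ ((j : ℕ) : ℤ)).coeff i ^ 2 / chebyshevWeight j)
    (fun j _ => mul_nonneg (chebyshevWeight_pos j).le (sq_nonneg _))
    (fun j _ => div_nonneg (sq_nonneg _) (chebyshevWeight_pos j).le)
    (fun j _ => by have := (chebyshevWeight_pos j).ne'; exact le_of_eq (by field_simp))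
  rw [coeff_chebyshevSum]
  refine (mul_le_mul_of_nonneg_right cauchy_schwarz (by positivity)).trans_eq ?_
  rw [mul_assoc, Finset.sum_mul (Finset.univ) _ (_ / _)]
  simp only [div_mul_eq_mul_div]

lemma integral_eval_T_cos_mul_eval_T_cos (i j : ℕ) :
    ∫ θ in (0 : ℝ)..Real.pi, (Chebyshev.T ℝ (i : ℤ)).eval (Real.cos θ) *
      (Chebyshev.T ℝ (j : ℤ)).eval (Real.cos θ) =
      if i = j then Real.pi * chebyshevWeight j else 0 := by
  rw [← Chebyshev.integral_measureT_eq_integral_cos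
    (f := fun x => (Chebyshev.T ℝ (i : ℤ)).eval x * (Chebyshev.T ℝ (j : ℤ)).eval x)]
  split_ifs with hij
  · subst hij
    rcases eq_or_ne i 0 with rfl | hi
    · simpa [chebyshevWeight] using Chebyshev.integral_eval_T_real_mul_self_measureT_zero
    · rw [Chebyshev.integral_T_real_mul_self_measureT_of_ne_zero hi, chebyshevWeight, if_neg hi,
        mul_one_div]
  · exact Chebyshev.integral_eval_T_real_mul_eval_T_real_measureT_of_ne hij

lemma integral_eval_chebyshevSum_cos_sq :
    ∫ θ in (0 : ℝ)..Real.pi, (chebyshevSum a).eval (Real.cos θ) ^ 2 =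
      Real.pi * ∑ j : Fin m, chebyshevWeight j * a j ^ 2 := by
  have hcont (i j : Fin m) : Continuous fun θ : ℝ => a i * a j *
      ((Chebyshev.T ℝ ((i : ℕ) : ℤ)).eval (Real.cos θ) *
        (Chebyshev.T ℝ ((j : ℕ) : ℤ)).eval (Real.cos θ)) := by
    fun_prop
  simp only [eval_chebyshevSum, sq, Finset.sum_mul_sum, mul_mul_mul_comm (a _)]
  rw [intervalIntegral.integral_finsetSum fun i _ =>
    (continuous_finsetSum _ fun j _ => hcont i j).intervalIntegrable _ _, Finset.mul_sum]
  refine Finset.sum_congr rfl fun i _ => ?_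
  rw [intervalIntegral.integral_finsetSum fun j _ => (hcont i j).intervalIntegrable _ _]
  simp only [intervalIntegral.integral_const_mul, integral_eval_T_cos_mul_eval_T_cos,
    Fin.val_inj, mul_ite, mul_zero, Finset.sum_ite_eq, Finset.mem_univ, if_true]
  ring

lemma exists_le_eval_chebyshevSum_sq :
    ∃ x : Dom,
      ∑ j : Fin m, chebyshevWeight j * a j ^ 2 ≤ (chebyshevSum a).eval (x : ℝ) ^ 2 := by
  by_contra! hlt
  have hlt_cos (θ : ℝ) := hlt ⟨Real.cos θ, Real.neg_one_le_cos θ, Real.cos_le_one θ⟩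
  have hint := intervalIntegral.integral_lt_integral_of_continuousOn_of_le_of_exists_lt
    (f := fun θ => (chebyshevSum a).eval (Real.cos θ) ^ 2)
    (g := fun _ => ∑ j : Fin m, chebyshevWeight j * a j ^ 2) Real.pi_pos (by fun_prop) (by fun_prop)
    (fun θ _ => (hlt_cos θ).le) ⟨0, by simp [Real.pi_pos.le], hlt_cos 0⟩
  rw [integral_eval_chebyshevSum_cos_sq] at hint
  simp at hint

lemma exists_chebyshevSum_eval_eq_zero {n : ℕ} (hnm : n < m) (x : Fin n → ℝ) :
    ∃ a : Fin m → ℝ, a ≠ 0 ∧ ∀ k, (chebyshevSum a).eval (x k) = 0 := by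
  obtain ⟨a, ha, ha_ne⟩ := (Submodule.ne_bot_iff _).1 <|
    LinearMap.ker_ne_bot_of_finrank_lt (f := Matrix.toLin'
      (Matrix.of fun k (j : Fin m) => (Chebyshev.T ℝ ((j : ℕ) : ℤ)).eval (x k))) (by simpa)
  refine ⟨a, ha_ne, fun k => ?_⟩
  simpa [eval_chebyshevSum, Matrix.mulVec, dotProduct, mul_comm] using
    congrFun (LinearMap.mem_ker.1 ha) k

lemma sum_chebyshevWeight_mul_sq_pos {a : Fin m → ℝ} (ha : a ≠ 0) :
    0 < ∑ j : Fin m, chebyshevWeight j * a j ^ 2 := by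
  obtain ⟨j, hj⟩ := Function.ne_iff.1 ha
  exact Finset.sum_pos' (fun i _ => mul_nonneg (chebyshevWeight_pos i).le (sq_nonneg _))
    ⟨j, Finset.mem_univ j, mul_pos (chebyshevWeight_pos j) (sq_pos_iff.2 hj)⟩

end ChebyshevSum

section LowerBound

open Polynomial

variable {ε : ℝ} {n : ℕ}

lemma LinApprox.eval_sub_apply_sq_le (hε : 0 < ε) [Fact (kernelMatrix (expKernel ε)).PosSemidef]
    (A : LinApprox n) (p : ℝ[X]) (x : Dom) :
    (p.eval (x : ℝ) - A.apply (fun y => p.eval (y : ℝ)) x) ^ 2 ≤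
      coeffNormSq ε p * ‖A.errorRep (RKHS.OfKernel (kernelMatrix (expKernel ε))) x‖ ^ 2 := by
  set e : ℕ → ℝ := fun i => expMonomial ε 0 i x - A.apply (expMonomial ε 0 i) x
  have heval : p.eval (x : ℝ) - A.apply (fun y => p.eval (y : ℝ)) x =
      ∑ i ∈ Finset.range (p.natDegree + 1), p.coeff i * e i := by
    simp only [e, apply, expMonomial, eval_eq_sum_range, mul_sub, Finset.sum_sub_distrib,
      Finset.mul_sum, Finset.sum_mul]
    rw [Finset.sum_comm]
    simp [mul_assoc]
  have hle : ∑ i ∈ Finset.range (p.natDegree + 1), ε ^ i / i ! * e i ^ 2 ≤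
      ‖A.errorRep (RKHS.OfKernel (kernelMatrix (expKernel ε))) x‖ ^ 2 :=
    sum_le_hasSum _ (fun _ _ => by positivity) (A.hasSum_norm_errorRep_expKernel_sq 0 x)
  rw [heval, coeffNormSq_eq_sum_range ε p.natDegree.lt_succ_self]
  refine (Finset.sum_sq_le_sum_mul_sum_of_sq_le_mul _
    (f := fun i => p.coeff i ^ 2 * (i ! / ε ^ i)) (g := fun i => ε ^ i / i ! * e i ^ 2)
    (fun i _ => by positivity) (fun i _ => by positivity) fun i _ => ?_).trans ?_
  · exact le_of_eq (by field_simp)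
  · gcongr

lemma LinApprox.exists_one_le_mul_norm_errorRep_sq (hε : 0 < ε)
    [Fact (kernelMatrix (expKernel ε)).PosSemidef] (hn : 5 * ε ≤ n) (hεn : 9 ≤ ε * n)
    (A : LinApprox n) :
    ∃ x, 1 ≤ 4 ^ n * n ! / ε ^ n * ((1 + ε) / 2 * Real.exp (ε ^ 2 / 16)) *
      ‖A.errorRep (RKHS.OfKernel (kernelMatrix (expKernel ε))) x‖ ^ 2 := by
  obtain ⟨a, ha, hzero⟩ := exists_chebyshevSum_eval_eq_zero n.lt_succ_self
    fun k => (A.point k : ℝ)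
  obtain ⟨x, hx⟩ := exists_le_eval_chebyshevSum_sq a
  refine ⟨x, le_of_mul_le_mul_left ?_ (sum_chebyshevWeight_mul_sq_pos ha)⟩
  set S := ∑ j : Fin (n + 1), chebyshevWeight j * a j ^ 2
  have hS : 0 ≤ S := (sum_chebyshevWeight_mul_sq_pos ha).le
  have herr := A.eval_sub_apply_sq_le hε (chebyshevSum a) x
  simp only [apply, hzero, zero_mul, Finset.sum_const_zero, sub_zero] at herr
  rw [mul_one, ← mul_assoc]
  refine (hx.trans herr).trans (mul_le_mul_of_nonneg_right ?_ (sq_nonneg _))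
  refine (coeffNormSq_chebyshevSum_le a hε).trans (mul_le_mul_of_nonneg_left ?_ hS)
  rw [Fin.sum_univ_eq_sum_range fun j =>
    coeffNormSq ε (Chebyshev.T ℝ (j : ℤ)) / chebyshevWeight j]
  exact sum_coeffNormSq_T_div_chebyshevWeight_le hε hn hεn

lemma c₁_mul_sq (hε : 0 < ε) :
    (c₁ ε * (√ε / 2) ^ n * (n ! : ℝ) ^ (-(1 / 2) : ℝ)) ^ 2 =
      (4 ^ n * n ! / ε ^ n * ((1 + ε) / 2 * Real.exp (ε ^ 2 / 16)))⁻¹ := by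
  have hexp : Real.exp (-(1 / 32) * ε ^ 2) ^ 2 = (Real.exp (ε ^ 2 / 16))⁻¹ := by
    rw [← Real.exp_nat_mul, ← Real.exp_neg]
    push_cast
    ring_nf
  rw [mul_pow, mul_pow, rpow_neg_half_sq (by positivity), pow_right_comm, div_pow,
    Real.sq_sqrt hε.le, c₁, mul_pow, Real.sq_sqrt (by positivity), hexp, div_pow,
    show (2 : ℝ) ^ 2 = 4 by norm_num]
  field_simp

lemma le_worstCaseError (hε : 0 < ε) (hn : mL ε ≤ n) (A : LinApprox n) :
    ENNReal.ofReal (c₁ ε * (√ε / 2) ^ n * (n ! : ℝ) ^ (-(1 / 2) : ℝ)) ≤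
      worstCaseError (expKernel ε) (expKernel_posSemidef hε.le) A := by
  have : Fact (kernelMatrix (expKernel ε)).PosSemidef := ⟨expKernel_posSemidef hε.le⟩
  obtain ⟨x, hx⟩ := A.exists_one_le_mul_norm_errorRep_sq hε (five_mul_le_of_mL_le hn)
    (nine_le_mul_of_mL_le hε hn)
  rw [worstCaseError, A.errorOn_eq_iSup_enorm_errorRep]
  refine le_iSup_of_le x ?_
  rw [← ofReal_norm]
  refine ENNReal.ofReal_le_ofReal (le_of_sq_le_sq ?_ (norm_nonneg _))
  rw [c₁_mul_sq hε]
  exact (inv_le_iff_one_le_mul₀' (by positivity)).2 hx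

end LowerBound

section UpperBound

open Polynomial

lemma T_eq_C_mul_prod_X_sub_C_cos (n : ℕ) :
    Chebyshev.T ℝ (n : ℤ) = C (2 ^ (n - 1)) *
      ∏ k ∈ Finset.range n, (X - C (Real.cos ((2 * k + 1) * Real.pi / (2 * n)))) := by
  have hroots : (Chebyshev.T ℝ (n : ℤ)).roots =
      (Finset.range n).val.map fun k : ℕ => Real.cos ((2 * k + 1) * Real.pi / (2 * n)) := by
    rw [Chebyshev.roots_T_real, Finset.image_val_of_injOn]
    exact (Finset.range n).nodup_map_iff_injOn.mp (Chebyshev.roots_T_real_nodup n)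
  have hcard : (Chebyshev.T ℝ (n : ℤ)).roots.card = (Chebyshev.T ℝ (n : ℤ)).natDegree := by
    simp [hroots, Chebyshev.natDegree_T]
  rw [(splits_iff_card_roots.2 hcard).eq_prod_roots, hroots, Chebyshev.leadingCoeff_T,
    Multiset.map_map]
  rfl

lemma exists_chebyshev_nodes {n : ℕ} (hn : n ≠ 0) : ∃ x : Fin n → Dom, Function.Injective x ∧
    ∀ y : Dom, |∏ k, ((y : ℝ) - x k)| ≤ 2 / 2 ^ n := by
  have hinj := (Finset.range n).nodup_map_iff_injOn.mp (Chebyshev.roots_T_real_nodup n)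
  refine ⟨fun k => ⟨Real.cos ((2 * (k : ℕ) + 1) * Real.pi / (2 * n)), Real.neg_one_le_cos _,
    Real.cos_le_one _⟩, fun i j hij => Fin.ext ?_, fun y => ?_⟩
  · exact hinj (by simp) (by simp) (Subtype.mk.inj hij)
  · have hT := Chebyshev.abs_eval_T_real_le_one n (abs_le.2 y.2)
    rw [T_eq_C_mul_prod_X_sub_C_cos, eval_mul, eval_C, eval_prod, Finset.prod_range, abs_mul,
      abs_of_pos (by positivity)] at hT
    simp only [eval_sub, eval_X, eval_C] at hT
    rw [← pow_sub_one_mul hn, le_div_iff₀ (by positivity)]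
    linarith

lemma abs_prod_sub_le_two_pow {ι : Type*} (t : Finset ι) (x : ι → Dom) (y : Dom) :
    |∏ k ∈ t, ((y : ℝ) - x k)| ≤ 2 ^ t.card := by
  rw [Finset.abs_prod, ← Finset.prod_const]
  refine Finset.prod_le_prod (fun _ _ => abs_nonneg _) fun k _ => ?_
  linarith [abs_sub (y : ℝ) (x k), abs_le.2 y.2, abs_le.2 (x k).2]

lemma exists_worstCaseError_le {ε : ℝ} (hε : 0 < ε) {n : ℕ} (hn : mL ε ≤ n) :
    ∃ A : LinApprox n, worstCaseError (expKernel ε) (expKernel_posSemidef hε.le) A ≤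
      ENNReal.ofReal (c₂ ε * (n : ℝ) ^ (-(1 / 8) : ℝ) * Real.exp √(ε * n) * (√ε / 2) ^ n *
        (n ! : ℝ) ^ (-(1 / 2) : ℝ)) := by
  have hn9 := nine_le_mul_of_mL_le hε hn
  have hn_ne : n ≠ 0 := by
    rintro rfl
    norm_num at hn9
  obtain ⟨x, hx, hprod⟩ := exists_chebyshev_nodes hn_ne
  refine ⟨weightedInterp ε x hx, (worstCaseError_weightedInterp_le hε hn hx hprod).trans_eq ?_⟩
  rw [c₂, div_pow]
  ring_nf

lemma worstCaseError_weightedInterp_le_two_mul_sqrt_pow {ε : ℝ} (hε : 0 < ε) {n : ℕ}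
    (hn : mL ε ≤ n) {x : Fin n → Dom} (hx : Function.Injective x) :
    worstCaseError (expKernel ε) (expKernel_posSemidef hε.le) (weightedInterp ε x hx) ≤
      ENNReal.ofReal (c₂ ε / 2 * (n : ℝ) ^ (-(1 / 8) : ℝ) * Real.exp √(ε * n) * (2 * √ε) ^ n *
        (n ! : ℝ) ^ (-(1 / 2) : ℝ)) := by
  refine (worstCaseError_weightedInterp_le hε hn hx (W := 2 ^ n) fun y => ?_).trans_eq ?_
  · simpa using abs_prod_sub_le_two_pow Finset.univ x y
  · rw [c₂, mul_pow]
    ring_nf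

end UpperBound

end ExpKernel

theorem mainTheorem7 (ε : ℝ) (hε : 0 < ε) (n : ℕ) (hn : ExpKernel.mL ε ≤ (n : ℝ)) :
    (ENNReal.ofReal (ExpKernel.c₁ ε * (√ε / 2) ^ n * (n ! : ℝ) ^ (-(1 / 2) : ℝ))
        ≤ ExpKernel.minimalError (ExpKernel.expKernel ε)
            (ExpKernel.expKernel_posSemidef hε.le) n ∧
      ExpKernel.minimalError (ExpKernel.expKernel ε)
            (ExpKernel.expKernel_posSemidef hε.le) n
        ≤ ENNReal.ofReal (ExpKernel.c₂ ε * (n : ℝ) ^ (-(1 / 8) : ℝ) * Real.exp √(ε * n)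
            * (√ε / 2) ^ n * (n ! : ℝ) ^ (-(1 / 2) : ℝ))) ∧
    ∀ x : Fin n → ExpKernel.Dom, Function.Injective x →
      ∃ A : ExpKernel.LinApprox n, A.point = x ∧
        ENNReal.ofReal (ExpKernel.c₁ ε * (√ε / 2) ^ n * (n ! : ℝ) ^ (-(1 / 2) : ℝ))
          ≤ ExpKernel.worstCaseError (ExpKernel.expKernel ε)
              (ExpKernel.expKernel_posSemidef hε.le) A ∧
        ExpKernel.worstCaseError (ExpKernel.expKernel ε)
              (ExpKernel.expKernel_posSemidef hε.le) A
          ≤ ENNReal.ofReal (ExpKernel.c₂ ε / 2 * (n : ℝ) ^ (-(1 / 8) : ℝ) * Real.exp √(ε * n)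
              * (2 * √ε) ^ n * (n ! : ℝ) ^ (-(1 / 2) : ℝ)) := by
  refine ⟨⟨le_iInf (ExpKernel.le_worstCaseError hε hn), ?_⟩, fun x hx => ?_⟩
  · obtain ⟨A, hA⟩ := ExpKernel.exists_worstCaseError_le hε hn
    exact (iInf_le _ A).trans hA
  · exact ⟨ExpKernel.weightedInterp ε x hx, rfl, ExpKernel.le_worstCaseError hε hn _,
      ExpKernel.worstCaseError_weightedInterp_le_two_mul_sqrt_pow hε hn hx⟩
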